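/- Let $n\ge 1$ and $N\ge 2$ be integers, let $\rho\in(0,\infty)$, let $\mathcal X$ and $E$ be measurable spaces, and give $\mathcal X^n$ the product $\sigma$-algebra. A randomized mechanism $M:\mathcal X^n\to E$ (a Markov kernel, $M(x)$ being the random output on the dataset $x$) is called $\rho$-zero concentrated differentially private ($\rho$-zCDP) if for all $x,y\in\mathcal X^n$ that differ in at most one coordinate and all $\alpha\in(1,\infty)$, $$D_\alpha\big(M(x)\,\|\,M(y)\big)\le \rho\,\alpha ,$$ where for probability distributions $\mathbb P\ll\mathbb Q$ $$D_\alpha(\mathbb P\|\mathbb Q)=\frac1{\alpha-1}\ln\int\Big(\frac{d\mathbb P}{d\mathbb Q}\Big)^{\alpha-1}d\mathbb P$$ is the Rényi divergence, taken between the laws of the outputs, with $D_\alpha(\mathbb P\|\mathbb Q)=+\infty$ if $\mathbb P\not\ll\mathbb Q$. Write $\mathrm{TV}(\mathbb P,\mathbb Q)=\sup_{S\text{ measurable}}\big(\mathbb P(S)-\mathbb Q(S)\big)$ for the total variation distance and $\mathrm{KL}(\mathbb P\|\mathbb Q)=\int\ln\frac{d\mathbb P}{d\mathbb Q}\,d\mathbb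 P\in[0,+\infty]$ for the Kullback–Leibler divergence. **Theorem (multiple distributional tests for $\rho$-zCDP).** Let $M:\mathcal X^n\to E$ be $\rho$-zCDP and let $\Psi:E\to\{1,\dots,N\}$ be any (measurable) test function. 1. For all probability distributions $\mathbb P_1,\dots,\mathbb P_N$ on $\mathcal X^n$ and every probability distribution $\mathbb Q$ on $\mathcal X^n$ such that $\mathbb P_i\ll\mathbb Q$ for all $i$, $$\max_{1\le i\le N}\ \mathbb P_{X\sim\mathbb P_i,\,M}\big(\Psi(M(X))\ne i\big)\ \ge\ \max\left\{1-\frac{1+\frac1N\sum_{i=1}^N\mathrm{KL}(\mathbb P_i\|\mathbb Q)}{\ln N}\,,\ \ 1-\frac{1+\frac{n^2\rho}{N^2}\sum_{i,j=1}^N\frac{2\,\mathrm{TV}(\mathbb P_i,\mathbb P_j)}{1+\mathrm{TV}(\mathbb P_i,\mathbb P_j)}}{\ln N}\right\},$$ where the first term on the right is $-\infty$ if some $\mathrm{KL}(\mathbb P_i\|\mathbb Q)$ is infinite. 2. Furthermore, when $\mathbb P_i=p_i^{\otimes n}$ for probability distributions $p_1,\dots,p_N$ on $\mathcal X$, $$\max_{1\le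 i\le N}\ \mathbb P_{X\sim p_i^{\otimes n},\,M}\big(\Psi(M(X))\ne i\big)\ \ge\ 1-\frac{1+\frac{n^2\rho}{N^2}\sum_{i,j=1}^N\left[\frac1n\,\frac{2\,\mathrm{TV}(p_i,p_j)}{1+\mathrm{TV}(p_i,p_j)}+\left(\frac{2\,\mathrm{TV}(p_i,p_j)}{1+\mathrm{TV}(p_i,p_j)}\right)^2\right]}{\ln N}.$$ -/

import Mathlib

open MeasureTheory ProbabilityTheory InformationTheory

namespace PrivateTesting

/-- Total variation distance `sup_S (μ S - ν S)` over measurable sets `S`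
(for probability measures the supremum is over a nonempty set bounded by `1`). -/
noncomputable def tvDist {α : Type*} [MeasurableSpace α] (μ ν : Measure α) : ℝ :=
  ⨆ S : {S : Set α // MeasurableSet S}, (μ.real S.1 - ν.real S.1)

open Classical in
/-- Rényi divergence of level `a ≥ 1` between two probability measures, with values in `EReal`:
the Kullback-Leibler divergence for `a = 1`, and
`(a - 1)⁻¹ * ln ∫ (dμ/dν) ^ (a - 1) dμ` for `a > 1`. As usual, it is `+∞` when `μ` is not
absolutely continuous with respect to `ν`. -/
noncomputable def renyiDiv {α : Type*} [MeasurableSpace α] (a : ℝ) (μ ν : Measure α) : EReal :=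
  if μ ≪ ν then
    if a = 1 then (klDiv μ ν : EReal)
    else (((a - 1)⁻¹ : ℝ) : EReal) * ENNReal.log (∫⁻ x, (μ.rnDeriv ν x) ^ (a - 1) ∂μ)
  else ⊤

open Classical in
/-- A randomized mechanism `M` on datasets of `n` records (a Markov kernel, `M x` being the law of
the output on the dataset `x`) is `ρ`-zero concentrated differentially private if
`D_a(M x ‖ M y) ≤ ρ a` for all datasets at Hamming distance at most `1` and all
`a ∈ (1, ∞)`. -/
def IsZCDP {𝒳 E : Type*} [MeasurableSpace 𝒳] [MeasurableSpace E] {n : ℕ}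
    (M : Kernel (Fin n → 𝒳) E) (ρ : ℝ) : Prop :=
  ∀ x y : Fin n → 𝒳, hammingDist x y ≤ 1 →
    ∀ a : ℝ, 1 < a → renyiDiv a (M x) (M y) ≤ ((ρ * a : ℝ) : EReal)

/-- The probability `ℙ(Ψ(M(X)) ≠ i)` when `X` has law `P i` and `M` is run on `X`;
`M ∘ₘ P i` is the law of the output `M(X)`. -/
noncomputable def testError {Ω E : Type*} [MeasurableSpace Ω] [MeasurableSpace E] {N : ℕ}
    (M : Kernel Ω E) (P : Fin N → Measure Ω) (Ψ : E → Fin N) (i : Fin N) : ℝ :=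
  (M ∘ₘ P i).real {y | Ψ y ≠ i}

/-- The maximal testing error over the `N` hypotheses (a maximum over a finite set). -/
noncomputable def maxTestError {Ω E : Type*} [MeasurableSpace Ω] [MeasurableSpace E] {N : ℕ}
    (M : Kernel Ω E) (P : Fin N → Measure Ω) (Ψ : E → Fin N) : ℝ :=
  ⨆ i : Fin N, testError M P Ψ i

end PrivateTesting

/-!
The bound rests on a test-function form of Fano's inequality that never mentions entropies. For
probability measures `μ`, `ν`, an event `A` and `t ≥ 0`, the Donsker-Varadhan formula applied to
`t • 1_A` gives `t μ(A) - log (1 + (exp t - 1) ν(A)) ≤ KL(μ ‖ ν)`, hence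
`t μ(A) - (exp t - 1) ν(A) ≤ KL(μ ‖ ν)`. With `t = log N`, `A = {Ψ = i}`, `μ` the law of the output
under the `i`-th hypothesis and `ν` a reference law, averaging over `i` bounds the average success
probability of `Ψ` by `(1 + average of the right-hand sides) / log N`, because the events
`{Ψ = i}` partition the output space (`fano_le_maxTestError`, and
`fano_le_maxTestError_of_pairwise` when the reference law is the mixture of the hypotheses). It
remains to bound these left-hand sides.

* For the KL term, the same linear inequality is proved on the dataset space for the test function
  `x ↦ M x (A)` with values in `[0, 1]`, so that no data processing theorem is needed
  (`mul_integral_sub_mul_integral_le_klDiv`).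
* For the privacy terms, the inequality holds pointwise: for all datasets `x`, `y` at Hamming
  distance `d`, `t (M x)(A) - log (1 + (exp t - 1) (M y)(A)) ≤ ρ d²` (`IsZCDP.mul_sub_log_le`).
  This is group privacy, proved by induction on `d`. Hölder's inequality with the Rényi bound of
  level `1 + l` turns a constant `K` valid at `z` into `(1 + 1 / l) K + (1 + l) ρ` at a neighbour
  of `z`; with `K = ρ d²` and `l = d` this is exactly `ρ (d + 1)²`.
* Integrating the pointwise bound against a coupling of two hypotheses leaves the second moment of
  a Hamming distance (`IsZCDP.comp_bound_of_coupling`). A maximal coupling of the dataset laws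
  bounds it by `n² TV`, and a product of maximal couplings of the record laws by `n TV + n² TV²`.
  Only pairs of hypotheses have to be coupled, so these bounds hold with `TV` itself, and
  `TV ≤ 2 TV / (1 + TV)` gives the claim.
-/

namespace PrivateTesting

open scoped ENNReal

/-! ### Group privacy on events -/

section GroupPrivacy

variable {E : Type*} [MeasurableSpace E]

lemma lintegral_rnDeriv_rpow_le_of_renyiDiv_le {μ ν : Measure E} {a c : ℝ} (ha : 1 < a)
    (h : renyiDiv a μ ν ≤ (c : EReal)) :
    μ ≪ ν ∧ ∫⁻ x, (μ.rnDeriv ν x) ^ (a - 1) ∂μ ≤ ENNReal.ofReal (Real.exp ((a - 1) * c)) := by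
  unfold renyiDiv at h
  have ha0 : 0 < a - 1 := by linarith
  split_ifs at h with hac ha1
  · linarith
  · refine ⟨hac, ?_⟩
    rw [← ENNReal.log_le_log_iff, ENNReal.log_ofReal_of_pos (Real.exp_pos _), Real.log_exp]
    generalize ENNReal.log (∫⁻ x, (μ.rnDeriv ν x) ^ (a - 1) ∂μ) = l at h ⊢
    induction l with
    | bot => exact bot_le
    | top =>
      rw [EReal.coe_mul_top_of_pos (inv_pos.mpr ha0)] at h
      exact absurd h (by simp)
    | coe l =>
      norm_cast at h ⊢
      rwa [inv_mul_le_iff₀ ha0] at h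
  · exact absurd h (by simp)

lemma lintegral_exp_indicator (μ : Measure E) [IsProbabilityMeasure μ] {A : Set E}
    (hA : MeasurableSet A) (s : ℝ) :
    ∫⁻ x, ENNReal.ofReal (Real.exp (A.indicator (fun _ => s) x)) ∂μ
      = ENNReal.ofReal (1 + (Real.exp s - 1) * μ.real A) := by
  have h1 : Integrable (fun x => 1 + (Real.exp s - 1) * A.indicator (fun _ => (1 : ℝ)) x) μ :=
    (integrable_const _).add (((integrable_const _).indicator hA).const_mul _)
  have h2 : ∀ x, Real.exp (A.indicator (fun _ => s) x)
      = 1 + (Real.exp s - 1) * A.indicator (fun _ => (1 : ℝ)) x := by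
    intro x
    by_cases hx : x ∈ A <;> simp [hx]
  simp_rw [h2]
  rw [← ofReal_integral_eq_lintegral_ofReal h1]
  · rw [integral_add (integrable_const _) (((integrable_const _).indicator hA).const_mul _),
      integral_const_mul, integral_indicator_const _ hA]
    simp
  · refine Filter.Eventually.of_forall fun x => ?_
    simp only [Pi.zero_apply]
    rw [← h2]
    positivity

/-- Hölder's inequality with exponents `1 + l` and `(1 + l) / l`, applied to `dμ/dν` and
`exp (l / (1 + l) * t * 1_A)`. -/
lemma log_one_add_exp_sub_one_mul_le {μ ν : Measure E} [IsProbabilityMeasure μ]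
    [IsProbabilityMeasure ν] {ρ l : ℝ} (hl : 0 < l)
    (h : renyiDiv (1 + l) μ ν ≤ ((ρ * (1 + l) : ℝ) : EReal)) {A : Set E}
    (hA : MeasurableSet A) {t : ℝ} (ht : 0 ≤ t) :
    Real.log (1 + (Real.exp (l / (1 + l) * t) - 1) * μ.real A)
      ≤ l * ρ + l / (1 + l) * Real.log (1 + (Real.exp t - 1) * ν.real A) := by
  obtain ⟨hac, hI⟩ := lintegral_rnDeriv_rpow_le_of_renyiDiv_le (by linarith) h
  rw [add_sub_cancel_left] at hI
  have hl1 : 0 < 1 + l := by linarith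
  set θ : ℝ := l / (1 + l) with hθ
  have hθ0 : 0 < θ := div_pos hl hl1
  have hpos : ∀ (κ : Measure E) (s : ℝ), 0 ≤ s → 0 < 1 + (Real.exp s - 1) * κ.real A := by
    intro κ s hs
    have := mul_nonneg (sub_nonneg.mpr (Real.one_le_exp hs)) (measureReal_nonneg (μ := κ) (s := A))
    linarith
  have hmeasInd : ∀ s : ℝ, Measurable
      (fun x => ENNReal.ofReal (Real.exp (A.indicator (fun _ => s) x))) := fun s =>
    ENNReal.measurable_ofReal.comp
      (Real.measurable_exp.comp ((measurable_const).indicator hA))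
  have hconj : (1 + l).HolderConjugate θ⁻¹ := by
    rw [Real.holderConjugate_iff]
    refine ⟨by linarith, ?_⟩
    rw [inv_inv, hθ]
    field_simp
  have key : ENNReal.ofReal (1 + (Real.exp (θ * t) - 1) * μ.real A)
      ≤ ENNReal.ofReal (Real.exp (l * (ρ * (1 + l)))) ^ (1 / (1 + l))
        * ENNReal.ofReal (1 + (Real.exp t - 1) * ν.real A) ^ θ := by
    rw [← lintegral_exp_indicator μ hA, ← lintegral_exp_indicator ν hA,
      ← lintegral_rnDeriv_mul hac (hmeasInd _).aemeasurable]
    refine (ENNReal.lintegral_mul_le_Lp_mul_Lq ν hconj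
      (Measure.measurable_rnDeriv _ _).aemeasurable (hmeasInd _).aemeasurable).trans ?_
    gcongr ?_ ^ _ * ?_
    · refine le_trans (le_of_eq ?_) hI
      rw [← lintegral_rnDeriv_mul hac ((Measure.measurable_rnDeriv _ _).pow_const _).aemeasurable]
      refine lintegral_congr fun x => ?_
      rw [ENNReal.rpow_add_of_nonneg _ _ zero_le_one hl.le, ENNReal.rpow_one]
    · rw [one_div, inv_inv]
      gcongr with x
      rw [ENNReal.ofReal_rpow_of_pos (Real.exp_pos _), ← Real.exp_mul]
      apply ENNReal.ofReal_le_ofReal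
      rw [Real.exp_le_exp]
      by_cases hx : x ∈ A
      · simp only [Set.indicator_of_mem hx]
        apply le_of_eq
        field_simp
      · simp [hx]
  rw [ENNReal.ofReal_rpow_of_pos (Real.exp_pos _), ENNReal.ofReal_rpow_of_pos (hpos _ _ ht),
    ← ENNReal.ofReal_mul (by positivity), ENNReal.ofReal_le_ofReal_iff (by
      have := hpos ν t ht
      positivity)] at key
  have := Real.log_le_log (hpos μ _ (by positivity)) key
  have h3 := hpos ν t ht
  rw [Real.log_mul (by positivity) (by positivity), ← Real.exp_mul, Real.log_exp,
    Real.log_rpow h3] at this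
  refine this.trans (le_of_eq ?_)
  field_simp

lemma exp_mul_le_one_add_exp_sub_one_mul {p : ℝ} (hp0 : 0 ≤ p) (hp1 : p ≤ 1) (t : ℝ) :
    Real.exp (t * p) ≤ 1 + (Real.exp t - 1) * p := by
  have := convexOn_exp.2 (Set.mem_univ (0 : ℝ)) (Set.mem_univ t)
    (sub_nonneg.mpr hp1) hp0 (by ring)
  simp only [smul_eq_mul, mul_zero, zero_add, Real.exp_zero] at this
  rw [mul_comm t p]
  linarith

/-- A Donsker-Varadhan bound `K` relative to `μ` (for multiples of the indicator of `A`) transfers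
to `ν` when the Rényi divergence of `μ` from `ν` is controlled; the test function `t • 1_A` for `ν`
is compared with `l / (1 + l) * t • 1_A` for `μ`. -/
lemma mul_sub_log_le_of_renyiDiv_le {μ ν : Measure E} [IsProbabilityMeasure μ]
    [IsProbabilityMeasure ν] {ρ l K p : ℝ} (hl : 0 < l)
    (h : renyiDiv (1 + l) μ ν ≤ ((ρ * (1 + l) : ℝ) : EReal)) {A : Set E}
    (hA : MeasurableSet A)
    (hK : ∀ t, 0 ≤ t → t * p - Real.log (1 + (Real.exp t - 1) * μ.real A) ≤ K)
    {t : ℝ} (ht : 0 ≤ t) :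
    t * p - Real.log (1 + (Real.exp t - 1) * ν.real A) ≤ (1 + 1 / l) * K + (1 + l) * ρ := by
  have h1 := log_one_add_exp_sub_one_mul_le hl h hA ht
  have h2 := hK (l / (1 + l) * t) (by positivity)
  have h3 : l / (1 + l) * (t * p - Real.log (1 + (Real.exp t - 1) * ν.real A)) ≤ K + l * ρ := by
    linarith
  rw [div_mul_eq_mul_div, div_le_iff₀ (by linarith)] at h3
  rw [← mul_le_mul_iff_right₀ hl]
  refine h3.trans (le_of_eq ?_)
  field_simp
  ring

open Classical in
lemma exists_hammingDist_eq {β : Type*} {n d : ℕ} {x y : Fin n → β}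
    (h : hammingDist x y = d + 1) :
    ∃ z : Fin n → β, hammingDist x z = d ∧ hammingDist z y ≤ 1 := by
  have hne : (Finset.univ.filter fun i => x i ≠ y i).Nonempty := by
    rw [← Finset.card_pos]
    unfold hammingDist at h
    omega
  obtain ⟨i, hi⟩ := hne
  refine ⟨Function.update y i (x i), ?_, ?_⟩
  · have : (Finset.univ.filter fun j => x j ≠ Function.update y i (x i) j)
        = (Finset.univ.filter fun j => x j ≠ y j).erase i := by
      ext j
      by_cases hj : j = i
      · subst hj; simp
      · simp [hj]
    unfold hammingDist at h ⊢
    rw [this, Finset.card_erase_of_mem hi]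
    omega
  · have : (Finset.univ.filter fun j => Function.update y i (x i) j ≠ y j) ⊆ {i} := by
      intro j hj
      by_contra hji
      simp only [Finset.mem_singleton] at hji
      simp [hji] at hj
    exact (Finset.card_le_card this).trans (by simp)

variable {𝒳 : Type*} [MeasurableSpace 𝒳] {n : ℕ}

open Classical in
/-- Group privacy: the Donsker-Varadhan form, for multiples of the indicator of `A`, of
`KL(M x ‖ M y) ≤ ρ d²` at Hamming distance `d`. -/
theorem IsZCDP.mul_sub_log_le {M : Kernel (Fin n → 𝒳) E} [IsMarkovKernel M] {ρ : ℝ}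
    (hM : IsZCDP M ρ) {A : Set E} (hA : MeasurableSet A) (x : Fin n → 𝒳) :
    ∀ (d : ℕ) (y : Fin n → 𝒳), hammingDist x y = d → ∀ t : ℝ, 0 ≤ t →
      t * (M x).real A - Real.log (1 + (Real.exp t - 1) * (M y).real A) ≤ ρ * (d : ℝ) ^ 2 := by
  have hbase : ∀ t : ℝ, 0 ≤ t →
      t * (M x).real A - Real.log (1 + (Real.exp t - 1) * (M x).real A) ≤ 0 := by
    intro t _
    have := Real.log_le_log (Real.exp_pos _)
      (exp_mul_le_one_add_exp_sub_one_mul (measureReal_nonneg (μ := M x) (s := A))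
        measureReal_le_one t)
    rw [Real.log_exp] at this
    linarith
  intro d
  induction d with
  | zero =>
    intro y hy t ht
    rw [← hammingDist_eq_zero.mp hy]
    simpa using hbase t ht
  | succ d ih =>
    intro y hy t ht
    obtain ⟨z, hxz, hzy⟩ := exists_hammingDist_eq hy
    rcases Nat.eq_zero_or_pos d with rfl | hd
    -- At `d = 0` the constant to transfer is `0`, so the level `1 + l` may tend to `1`.
    · rw [← hammingDist_eq_zero.mp hxz] at hzy
      have hlim : ∀ l : ℝ, 0 < l →
          t * (M x).real A - Real.log (1 + (Real.exp t - 1) * (M y).real A) ≤ (1 + l) * ρ := by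
        intro l hl
        have := mul_sub_log_le_of_renyiDiv_le hl (hM x y hzy _ (by linarith)) hA hbase ht
        simpa using this
      have hten : Filter.Tendsto (fun l : ℝ => (1 + l) * ρ) (nhdsWithin 0 (Set.Ioi 0))
          (nhds ((1 + 0) * ρ)) := by
        apply Filter.Tendsto.mono_left _ nhdsWithin_le_nhds
        exact Continuous.tendsto (by fun_prop) 0
      have := ge_of_tendsto hten (eventually_nhdsWithin_of_forall hlim)
      simpa using this
    -- The choice `l = d` minimizes `(1 + 1 / l) * (ρ * d ^ 2) + (1 + l) * ρ`.
    · have hd' : (0 : ℝ) < d := by exact_mod_cast hd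
      have := mul_sub_log_le_of_renyiDiv_le hd' (hM z y hzy _ (by linarith)) hA
        (ih z hxz) ht
      refine this.trans (le_of_eq ?_)
      push_cast
      field_simp
      ring

open Classical in
theorem IsZCDP.mul_sub_mul_le {M : Kernel (Fin n → 𝒳) E} [IsMarkovKernel M] {ρ : ℝ}
    (hM : IsZCDP M ρ) {A : Set E} (hA : MeasurableSet A) (x y : Fin n → 𝒳) {t : ℝ} (ht : 0 ≤ t) :
    t * (M x).real A - (Real.exp t - 1) * (M y).real A ≤ ρ * (hammingDist x y : ℝ) ^ 2 := by
  have h1 := hM.mul_sub_log_le hA x _ y rfl t ht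
  have h0 : 0 ≤ (Real.exp t - 1) * (M y).real A :=
    mul_nonneg (sub_nonneg.mpr (Real.one_le_exp ht)) measureReal_nonneg
  have h2 := Real.log_le_sub_one_of_pos (show 0 < 1 + (Real.exp t - 1) * (M y).real A by linarith)
  linarith

end GroupPrivacy

/-! ### Maximal couplings -/

section Coupling

variable {α : Type*} [MeasurableSpace α]

lemma bddAbove_tvDist (μ ν : Measure α) [IsProbabilityMeasure μ] [IsProbabilityMeasure ν] :
    BddAbove (Set.range fun S : {S : Set α // MeasurableSet S} => μ.real S.1 - ν.real S.1) := by
  refine ⟨1, ?_⟩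
  rintro _ ⟨S, rfl⟩
  have h1 : μ.real S.1 ≤ 1 := measureReal_le_one
  have h2 : 0 ≤ ν.real S.1 := measureReal_nonneg
  simp only
  linarith

lemma tvDist_nonneg (μ ν : Measure α) [IsProbabilityMeasure μ] [IsProbabilityMeasure ν] :
    0 ≤ tvDist μ ν :=
  le_ciSup_of_le (bddAbove_tvDist μ ν) ⟨∅, MeasurableSet.empty⟩ (by simp)

lemma tvDist_le_one (μ ν : Measure α) [IsProbabilityMeasure μ] [IsProbabilityMeasure ν] :
    tvDist μ ν ≤ 1 := by
  have : Nonempty {S : Set α // MeasurableSet S} := ⟨⟨∅, MeasurableSet.empty⟩⟩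
  refine ciSup_le fun S => ?_
  have h1 : μ.real S.1 ≤ 1 := measureReal_le_one
  have h2 : 0 ≤ ν.real S.1 := measureReal_nonneg
  linarith

lemma tvDist_le_two_mul_div (μ ν : Measure α) [IsProbabilityMeasure μ] [IsProbabilityMeasure ν] :
    tvDist μ ν ≤ 2 * tvDist μ ν / (1 + tvDist μ ν) := by
  have h0 := tvDist_nonneg μ ν
  have h1 := tvDist_le_one μ ν
  rw [le_div_iff₀ (by linarith)]
  nlinarith

/-- Two probability measures split into a common part and two remainders of equal mass at most
their total variation distance. -/
lemma exists_common_part (μ ν : Measure α) [IsProbabilityMeasure μ] [IsProbabilityMeasure ν] :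
    ∃ m δ ε : Measure α, μ = m + δ ∧ ν = m + ε ∧ δ Set.univ = ε Set.univ ∧
      δ.real Set.univ ≤ tvDist μ ν := by
  obtain ⟨s, hs, h1, h2⟩ := hahn_decomposition μ ν
  have hle1 : ν.restrict s ≤ μ.restrict s := by
    refine Measure.le_iff.mpr fun t ht => ?_
    rw [Measure.restrict_apply ht, Measure.restrict_apply ht]
    exact h1 _ (ht.inter hs) Set.inter_subset_right
  have hle2 : μ.restrict sᶜ ≤ ν.restrict sᶜ := by
    refine Measure.le_iff.mpr fun t ht => ?_
    rw [Measure.restrict_apply ht, Measure.restrict_apply ht]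
    exact h2 _ (ht.inter hs.compl) Set.inter_subset_right
  have hμ : μ = (ν.restrict s + μ.restrict sᶜ) + (μ.restrict s - ν.restrict s) := by
    conv_lhs => rw [← Measure.restrict_add_restrict_compl (μ := μ) hs,
      ← Measure.sub_add_cancel_of_le hle1]
    rw [add_assoc, add_comm]
  have hν : ν = (ν.restrict s + μ.restrict sᶜ) + (ν.restrict sᶜ - μ.restrict sᶜ) := by
    conv_lhs => rw [← Measure.restrict_add_restrict_compl (μ := ν) hs,
      ← Measure.sub_add_cancel_of_le hle2]
    rw [add_comm (_ - _), ← add_assoc]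
  refine ⟨_, _, _, hμ, hν, ?_, ?_⟩
  · have e1 := congrArg (fun κ : Measure α => κ Set.univ) hμ
    have e2 := congrArg (fun κ : Measure α => κ Set.univ) hν
    simp only [measure_univ] at e1 e2
    rw [Measure.add_apply] at e1 e2
    have hfin : (ν.restrict s + μ.restrict sᶜ) Set.univ ≠ ∞ := measure_ne_top _ _
    exact (ENNReal.add_right_inj hfin).mp (e1.symm.trans e2)
  · refine le_trans (le_of_eq ?_) (le_ciSup (bddAbove_tvDist μ ν) ⟨s, hs⟩)
    rw [measureReal_def, Measure.sub_apply MeasurableSet.univ hle1,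
      Measure.restrict_apply_univ, Measure.restrict_apply_univ,
      ENNReal.toReal_sub_of_le (h1 s hs subset_rfl) (measure_ne_top _ _)]
    rfl

/-- A maximal coupling. The space `α ⊕ α × α` records whether the two samples are drawn together
from the common part (left) or independently from the remainders (right), so that the event `D`
outside of which they agree is measurable even if the diagonal of `α × α` is not. -/
theorem exists_maximal_coupling (μ ν : Measure α) [IsProbabilityMeasure μ]
    [IsProbabilityMeasure ν] :
    ∃ (π : Measure (α ⊕ α × α)) (X Y : α ⊕ α × α → α) (D : Set (α ⊕ α × α)),
      IsProbabilityMeasure π ∧ Measurable X ∧ Measurable Y ∧ MeasurableSet D ∧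
      (∀ ω, ω ∉ D → X ω = Y ω) ∧ π.map X = μ ∧ π.map Y = ν ∧ π.real D ≤ tvDist μ ν := by
  obtain ⟨m, δ, ε, hμ, hν, hmass, htv⟩ := exists_common_part μ ν
  have hδμ : δ ≤ μ := by rw [hμ]; exact Measure.le_add_left le_rfl
  have hεν : ε ≤ ν := by rw [hν]; exact Measure.le_add_left le_rfl
  have : IsFiniteMeasure δ := isFiniteMeasure_of_le μ hδμ
  have : IsFiniteMeasure ε := isFiniteMeasure_of_le ν hεν
  have hX : Measurable (Sum.elim id Prod.fst : α ⊕ α × α → α) :=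
    measurable_id.sumElim measurable_fst
  have hY : Measurable (Sum.elim id Prod.snd : α ⊕ α × α → α) :=
    measurable_id.sumElim measurable_snd
  -- If the remainders vanish, the factor `⊤` multiplies the zero measure.
  have hsmul : ∀ κ : Measure α, κ Set.univ = δ Set.univ →
      (δ Set.univ)⁻¹ • δ Set.univ • κ = κ := by
    intro κ hκ
    rw [smul_smul]
    by_cases h0 : δ Set.univ = 0
    · rw [h0, Measure.measure_univ_eq_zero] at hκ
      rw [hκ, smul_zero]
    · rw [ENNReal.inv_mul_cancel h0 (measure_ne_top _ _), one_smul]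
  set π : Measure (α ⊕ α × α) :=
    m.map Sum.inl + (δ Set.univ)⁻¹ • (δ.prod ε).map Sum.inr with hπ
  have hmapX : π.map (Sum.elim id Prod.fst) = μ := by
    rw [hπ, Measure.map_add _ _ hX, Measure.map_smul, Measure.map_map hX measurable_inl,
      Measure.map_map hX measurable_inr, Sum.elim_comp_inl, Sum.elim_comp_inr, Measure.map_id,
      Measure.map_fst_prod, ← hmass, hsmul δ rfl, ← hμ]
  have hmapY : π.map (Sum.elim id Prod.snd) = ν := by
    rw [hπ, Measure.map_add _ _ hY, Measure.map_smul, Measure.map_map hY measurable_inl,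
      Measure.map_map hY measurable_inr, Sum.elim_comp_inl, Sum.elim_comp_inr, Measure.map_id,
      Measure.map_snd_prod, hsmul ε hmass.symm, ← hν]
  have hprob : IsProbabilityMeasure π := by
    constructor
    have : π.map (Sum.elim id Prod.fst) Set.univ = 1 := by rw [hmapX]; exact measure_univ
    rwa [Measure.map_apply hX MeasurableSet.univ, Set.preimage_univ] at this
  refine ⟨π, _, _, Set.range Sum.inr, hprob, hX, hY, measurableSet_range_inr, ?_, hmapX, hmapY,
    ?_⟩
  · rintro (ω | ω) hω
    · rfl
    · exact absurd ⟨ω, rfl⟩ hω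
  · refine le_trans (le_of_eq ?_) htv
    have e1 : m (Sum.inl ⁻¹' Set.range (Sum.inr : α × α → α ⊕ α × α)) = 0 := by
      simp
    have e2 := congrArg (fun κ : Measure α => κ Set.univ) (hsmul δ rfl)
    simp only [Measure.smul_apply, smul_eq_mul] at e2
    rw [measureReal_def, measureReal_def, hπ, Measure.add_apply, Measure.smul_apply,
      Measure.map_apply measurable_inl measurableSet_range_inr,
      Measure.map_apply measurable_inr measurableSet_range_inr, e1, zero_add,
      Set.preimage_range, ← Set.univ_prod_univ, Measure.prod_prod, ← hmass, smul_eq_mul, e2]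

end Coupling

/-! ### Second moment of a number of successes -/

section Moments

variable {Ω : Type*} [MeasurableSpace Ω] {n : ℕ}

lemma integral_sum_indicator_sq_le (π : Measure Ω) [IsProbabilityMeasure π] {D : Set Ω}
    (hD : MeasurableSet D) :
    Integrable (fun ω : Fin n → Ω => (∑ k, D.indicator (fun _ => (1 : ℝ)) (ω k)) ^ 2)
      (Measure.pi fun _ => π) ∧
    ∫ ω : Fin n → Ω, (∑ k, D.indicator (fun _ => (1 : ℝ)) (ω k)) ^ 2 ∂(Measure.pi fun _ => π)
      ≤ n * π.real D + (n : ℝ) ^ 2 * π.real D ^ 2 := by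
  have hmeas : ∀ k : Fin n, MeasurableSet {ω : Fin n → Ω | ω k ∈ D} := fun k =>
    measurable_pi_apply k hD
  have hset : ∀ k l : Fin n, MeasurableSet ({ω : Fin n → Ω | ω k ∈ D} ∩ {ω | ω l ∈ D}) :=
    fun k l => (hmeas k).inter (hmeas l)
  have hexp : (fun ω : Fin n → Ω => (∑ k, D.indicator (fun _ => (1 : ℝ)) (ω k)) ^ 2)
      = fun ω => ∑ k, ∑ l, ({ω : Fin n → Ω | ω k ∈ D} ∩ {ω | ω l ∈ D}).indicator
        (fun _ => (1 : ℝ)) ω := by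
    funext ω
    rw [sq, Finset.sum_mul_sum]
    refine Finset.sum_congr rfl fun k _ => Finset.sum_congr rfl fun l _ => ?_
    by_cases hk : ω k ∈ D <;> by_cases hl : ω l ∈ D <;> simp [hk, hl]
  have hint : ∀ k l : Fin n, Integrable
      (({ω : Fin n → Ω | ω k ∈ D} ∩ {ω | ω l ∈ D}).indicator (fun _ => (1 : ℝ)))
      (Measure.pi fun _ => π) := fun k l => (integrable_const _).indicator (hset k l)
  have hone : ∀ k : Fin n, (Measure.pi fun _ : Fin n => π).real {ω | ω k ∈ D} = π.real D := by
    intro k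
    exact (measurePreserving_eval (fun _ : Fin n => π) k).measureReal_preimage
      hD.nullMeasurableSet
  have hval : ∀ k l : Fin n, (Measure.pi fun _ : Fin n => π).real
      ({ω : Fin n → Ω | ω k ∈ D} ∩ {ω | ω l ∈ D})
      ≤ (if k = l then π.real D else 0) + π.real D ^ 2 := by
    intro k l
    split_ifs with hkl
    · subst hkl
      rw [Set.inter_self, hone]
      have := sq_nonneg (π.real D)
      linarith
    · have hind : iIndepFun (fun (i : Fin n) (ω : Fin n → Ω) => ω i) (Measure.pi fun _ => π) :=
        iIndepFun_pi (X := fun _ => id) (fun _ => aemeasurable_id)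
      have := (hind.indepFun hkl).measure_inter_preimage_eq_mul D D hD hD
      have e1 := hone k
      have e2 := hone l
      rw [measureReal_def] at e1 e2 ⊢
      simp only [Set.preimage] at this
      rw [this, ENNReal.toReal_mul, e1, e2]
      exact le_of_eq (by ring)
  rw [hexp]
  refine ⟨integrable_finsetSum _ fun k _ => integrable_finsetSum _ fun l _ => hint k l, ?_⟩
  rw [integral_finsetSum _ fun k _ => integrable_finsetSum _ fun l _ => hint k l]
  simp_rw [integral_finsetSum _ fun l _ => hint _ l, integral_indicator_const _ (hset _ _)]
  simp only [smul_eq_mul, mul_one]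
  refine (Finset.sum_le_sum fun k _ => Finset.sum_le_sum fun l _ => hval k l).trans ?_
  simp only [Finset.sum_add_distrib, Finset.sum_ite_eq, Finset.mem_univ, if_true,
    Finset.sum_const, Finset.card_univ, Fintype.card_fin, nsmul_eq_mul]
  exact le_of_eq (by ring)

end Moments

/-! ### A linear lower bound on the Kullback-Leibler divergence -/

section KL

variable {α : Type*} [MeasurableSpace α]

/-- Young's inequality for `klFun` and its convex conjugate `s ↦ exp s - 1`. -/
lemma mul_sub_exp_le_klFun {x : ℝ} (hx : 0 ≤ x) (s : ℝ) :
    x * s - (Real.exp s - 1) ≤ klFun x := by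
  rw [klFun_apply]
  rcases hx.eq_or_lt with rfl | hx
  · simp only [zero_mul, zero_sub, zero_add, sub_zero]
    linarith [Real.exp_pos s]
  · have h1 := Real.add_one_le_exp (s - Real.log x)
    rw [Real.exp_sub, Real.exp_log hx, le_div_iff₀ hx] at h1
    linarith

lemma mul_integral_sub_mul_integral_le_klDiv {μ ν : Measure α} [IsProbabilityMeasure μ]
    [IsProbabilityMeasure ν] (h : klDiv μ ν ≠ ∞) {u : α → ℝ} (hu : Measurable u)
    (hu0 : ∀ x, 0 ≤ u x) (hu1 : ∀ x, u x ≤ 1) (t : ℝ) :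
    t * ∫ x, u x ∂μ - (Real.exp t - 1) * ∫ x, u x ∂ν ≤ (klDiv μ ν).toReal := by
  obtain ⟨hac, hint⟩ := klDiv_ne_top_iff.mp h
  have hub : ∀ κ : Measure α, IsProbabilityMeasure κ → Integrable u κ := fun κ _ =>
    Integrable.of_bound hu.aestronglyMeasurable 1
      (Filter.Eventually.of_forall fun x => by
        rw [Real.norm_eq_abs, abs_of_nonneg (hu0 x)]; exact hu1 x)
  have hi1 : Integrable (fun x => (μ.rnDeriv ν x).toReal * u x) ν := by
    have := (integrable_rnDeriv_smul_iff hac (f := u)).mpr (hub μ inferInstance)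
    simpa using this
  have hi2 := (hub ν inferInstance).const_mul (Real.exp t - 1)
  rw [toReal_klDiv_eq_integral_klFun hac]
  have heq : ∫ x, u x ∂μ = ∫ x, (μ.rnDeriv ν x).toReal * u x ∂ν := by
    rw [← integral_rnDeriv_smul hac]
    simp
  rw [heq, ← integral_const_mul, ← integral_const_mul, ← integral_sub (hi1.const_mul t) hi2]
  refine integral_mono ((hi1.const_mul t).sub hi2)
    ((integrable_klFun_rnDeriv_iff hac).mpr hint) fun x => ?_
  have h1 := mul_sub_exp_le_klFun (x := (μ.rnDeriv ν x).toReal) ENNReal.toReal_nonneg (t * u x)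
  have h2 := exp_mul_le_one_add_exp_sub_one_mul (hu0 x) (hu1 x) t
  simp only
  linarith

end KL

/-! ### Fano's inequality -/

section Testing

variable {Ω E : Type*} [MeasurableSpace Ω] [MeasurableSpace E] {N : ℕ}

lemma comp_real_apply (M : Kernel Ω E) [IsMarkovKernel M] (P : Measure Ω)
    [IsProbabilityMeasure P] {A : Set E} (hA : MeasurableSet A) :
    (M ∘ₘ P).real A = ∫ x, (M x).real A ∂P := by
  rw [measureReal_def, Measure.bind_apply hA M.aemeasurable]
  simp_rw [measureReal_def]
  rw [integral_toReal (M.measurable_coe hA).aemeasurable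
    (Filter.Eventually.of_forall fun x => measure_lt_top _ _)]

lemma integrable_real_apply (M : Kernel Ω E) [IsMarkovKernel M] (P : Measure Ω)
    [IsProbabilityMeasure P] {A : Set E} (hA : MeasurableSet A) :
    Integrable (fun x => (M x).real A) P :=
  Integrable.of_bound (M.measurable_coe hA).ennreal_toReal.aestronglyMeasurable 1
    (Filter.Eventually.of_forall fun x => by
      rw [Real.norm_eq_abs, abs_of_nonneg measureReal_nonneg]; exact measureReal_le_one)

lemma sum_real_preimage_singleton (κ : Measure E) [IsProbabilityMeasure κ] {Ψ : E → Fin N}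
    (hΨ : Measurable Ψ) : ∑ i, κ.real (Ψ ⁻¹' {i}) = 1 := by
  rw [sum_measureReal_preimage_singleton _ fun i _ => hΨ (measurableSet_singleton i)]
  simp

lemma testError_eq (M : Kernel Ω E) [IsMarkovKernel M] (P : Fin N → Measure Ω)
    [∀ i, IsProbabilityMeasure (P i)] {Ψ : E → Fin N} (hΨ : Measurable Ψ) (i : Fin N) :
    testError M P Ψ i = 1 - (M ∘ₘ P i).real (Ψ ⁻¹' {i}) := by
  rw [← probReal_compl_eq_one_sub (hΨ (measurableSet_singleton i))]
  rfl

/-- Fano's inequality: `q i` is the probability that a reference law gives to `{Ψ = i}`, and `k i`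
bounds the linearized divergence of the `i`-th output law from it. -/
theorem fano_le_maxTestError (hN : 2 ≤ N) (M : Kernel Ω E) [IsMarkovKernel M]
    (P : Fin N → Measure Ω) [∀ i, IsProbabilityMeasure (P i)] {Ψ : E → Fin N}
    (hΨ : Measurable Ψ) {q k : Fin N → ℝ} (hq : ∑ i, q i ≤ 1)
    (h : ∀ i, Real.log N * (M ∘ₘ P i).real (Ψ ⁻¹' {i}) - (N - 1) * q i ≤ k i) :
    1 - (1 + 1 / (N : ℝ) * ∑ i, k i) / Real.log N ≤ maxTestError M P Ψ := by
  have hN' : (2 : ℝ) ≤ N := by exact_mod_cast hN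
  have hlog : 0 < Real.log N := Real.log_pos (by linarith)
  have hmax : ∀ i, 1 - (M ∘ₘ P i).real (Ψ ⁻¹' {i}) ≤ maxTestError M P Ψ := fun i =>
    (testError_eq M P hΨ i).symm.le.trans
      (le_ciSup (f := fun i => testError M P Ψ i) (Set.finite_range _).bddAbove i)
  have h1 := Finset.sum_le_sum fun i (_ : i ∈ Finset.univ) => h i
  have h2 := Finset.sum_le_sum fun i (_ : i ∈ Finset.univ) => hmax i
  rw [Finset.sum_sub_distrib, ← Finset.mul_sum, ← Finset.mul_sum] at h1
  rw [Finset.sum_sub_distrib] at h2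
  simp only [Finset.sum_const, Finset.card_univ, Fintype.card_fin, nsmul_eq_mul, mul_one] at h2
  set s := ∑ i, (M ∘ₘ P i).real (Ψ ⁻¹' {i})
  set K := ∑ i, k i
  have h3 : (N - 1 : ℝ) * ∑ i, q i ≤ N := by nlinarith
  have h4 : 1 - s / N ≤ maxTestError M P Ψ := by
    rw [sub_le_iff_le_add, ← sub_le_iff_le_add', le_div_iff₀ (by linarith)]
    linarith
  refine le_trans ?_ h4
  rw [sub_le_sub_iff_left, div_le_div_iff₀ (by linarith) hlog]
  have : (1 + 1 / (N : ℝ) * K) * N = N + K := by field_simp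
  rw [this]
  linarith

/-- Fano's inequality with the uniform mixture of the output laws as reference law. -/
theorem fano_le_maxTestError_of_pairwise (hN : 2 ≤ N) (M : Kernel Ω E) [IsMarkovKernel M]
    (P : Fin N → Measure Ω) [∀ i, IsProbabilityMeasure (P i)] {Ψ : E → Fin N}
    (hΨ : Measurable Ψ) (c : ℝ) {k : Fin N → Fin N → ℝ}
    (h : ∀ i j, Real.log N * (M ∘ₘ P i).real (Ψ ⁻¹' {i})
      - (N - 1) * (M ∘ₘ P j).real (Ψ ⁻¹' {i}) ≤ c * k i j) :
    1 - (1 + c / (N : ℝ) ^ 2 * ∑ i, ∑ j, k i j) / Real.log N ≤ maxTestError M P Ψ := by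
  have hN0 : (0 : ℝ) < N := by exact_mod_cast (by omega : 0 < N)
  have := fano_le_maxTestError hN M P hΨ
    (q := fun i => 1 / (N : ℝ) * ∑ j, (M ∘ₘ P j).real (Ψ ⁻¹' {i}))
    (k := fun i => 1 / (N : ℝ) * ∑ j, c * k i j) ?_ ?_
  · refine le_trans (le_of_eq ?_) this
    simp_rw [← Finset.mul_sum]
    congr 3
    field_simp
  · rw [← Finset.mul_sum, Finset.sum_comm]
    simp_rw [sum_real_preimage_singleton _ hΨ]
    simp [hN0.ne']
  · intro i
    have h1 := Finset.sum_le_sum fun j (_ : j ∈ Finset.univ) => h i j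
    rw [Finset.sum_sub_distrib, ← Finset.mul_sum] at h1
    simp only [Finset.sum_const, Finset.card_univ, Fintype.card_fin, nsmul_eq_mul] at h1
    have h2 := mul_le_mul_of_nonneg_left h1 (one_div_nonneg.mpr hN0.le)
    refine le_trans (le_of_eq ?_) h2
    rw [← Finset.mul_sum]
    field_simp

theorem fano_klDiv_le_maxTestError (hN : 2 ≤ N) (M : Kernel Ω E) [IsMarkovKernel M]
    (P : Fin N → Measure Ω) (Q : Measure Ω) [∀ i, IsProbabilityMeasure (P i)]
    [IsProbabilityMeasure Q] {Ψ : E → Fin N} (hΨ : Measurable Ψ) :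
    1 - (1 + ((1 / (N : ℝ) : ℝ) : EReal) * ∑ i : Fin N, (klDiv (P i) Q : EReal)) /
          ((Real.log N : ℝ) : EReal) ≤ ((maxTestError M P Ψ : ℝ) : EReal) := by
  have hN0 : (0 : ℝ) < N := by exact_mod_cast (by omega : 0 < N)
  have hlog : 0 < Real.log N := Real.log_pos (by exact_mod_cast (by omega : 1 < N))
  by_cases hfin : ∀ i, klDiv (P i) Q ≠ ∞
  · have hreal : ∀ i, (klDiv (P i) Q : EReal) = (((klDiv (P i) Q).toReal : ℝ) : EReal) :=
      fun i => (EReal.coe_ennreal_toReal (hfin i)).symm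
    simp_rw [hreal]
    have := fano_le_maxTestError hN M P hΨ (q := fun i => (M ∘ₘ Q).real (Ψ ⁻¹' {i}))
      (k := fun i => (klDiv (P i) Q).toReal) (sum_real_preimage_singleton _ hΨ).le ?_
    · have hsum : ∑ i, (((klDiv (P i) Q).toReal : ℝ) : EReal)
          = ((∑ i, (klDiv (P i) Q).toReal : ℝ) : EReal) :=
        (map_sum (⟨⟨Real.toEReal, EReal.coe_zero⟩, EReal.coe_add⟩ : ℝ →+ EReal) _ _).symm
      rw [hsum]
      rw [← EReal.coe_mul, ← EReal.coe_one, ← EReal.coe_add, ← EReal.coe_div, ← EReal.coe_sub]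
      exact EReal.coe_le_coe_iff.mpr this
    · intro i
      have hA := hΨ (measurableSet_singleton i)
      have := mul_integral_sub_mul_integral_le_klDiv (hfin i)
        (u := fun x => (M x).real (Ψ ⁻¹' {i})) (M.measurable_coe hA).ennreal_toReal
        (fun _ => measureReal_nonneg) (fun _ => measureReal_le_one) (Real.log N)
      rwa [Real.exp_log hN0, ← comp_real_apply M _ hA, ← comp_real_apply M _ hA] at this
  · push Not at hfin
    obtain ⟨i, hi⟩ := hfin
    have hsum : ∑ i : Fin N, (klDiv (P i) Q : EReal) = ⊤ := by
      have h1 : (klDiv (P i) Q : EReal) ≤ ∑ i : Fin N, (klDiv (P i) Q : EReal) :=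
        Finset.single_le_sum (f := fun i => (klDiv (P i) Q : EReal))
          (fun j _ => EReal.coe_ennreal_nonneg _) (Finset.mem_univ i)
      rw [hi] at h1
      exact top_le_iff.mp h1
    rw [hsum, EReal.coe_mul_top_of_pos (by positivity),
      EReal.add_top_of_ne_bot (by exact_mod_cast EReal.coe_ne_bot 1),
      EReal.top_div_of_pos_ne_top (by exact_mod_cast hlog) (EReal.coe_ne_top _), EReal.sub_top]
    exact bot_le

end Testing

/-! ### Output laws of private mechanisms -/

section Privacy

variable {𝒳 E : Type*} [MeasurableSpace 𝒳] [MeasurableSpace E] {n : ℕ}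

open Classical in
/-- The pointwise group privacy bound, integrated against a coupling `(X, Y)` of two dataset laws. -/
lemma IsZCDP.comp_bound_of_coupling {M : Kernel (Fin n → 𝒳) E} [IsMarkovKernel M] {ρ : ℝ}
    (hρ : 0 ≤ ρ) (hM : IsZCDP M ρ) {A : Set E} (hA : MeasurableSet A) {t : ℝ} (ht : 0 ≤ t)
    {P P' : Measure (Fin n → 𝒳)} [IsProbabilityMeasure P] [IsProbabilityMeasure P']
    {Ω : Type*} [MeasurableSpace Ω] {π : Measure Ω} {X Y : Ω → Fin n → 𝒳}
    (hX : Measurable X) (hY : Measurable Y) (hmX : π.map X = P) (hmY : π.map Y = P')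
    {c : Ω → ℝ} (hc : Integrable c π) (hd : ∀ ω, (hammingDist (X ω) (Y ω) : ℝ) ^ 2 ≤ c ω) :
    t * (M ∘ₘ P).real A - (Real.exp t - 1) * (M ∘ₘ P').real A ≤ ρ * ∫ ω, c ω ∂π := by
  have hi1 := integrable_real_apply M P hA
  have hi2 := integrable_real_apply M P' hA
  rw [comp_real_apply M P hA, comp_real_apply M P' hA]
  subst hmX hmY
  rw [integral_map hX.aemeasurable hi1.aestronglyMeasurable,
    integral_map hY.aemeasurable hi2.aestronglyMeasurable, ← integral_const_mul,
    ← integral_const_mul, ← integral_const_mul]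
  have hi1' := (hi1.comp_measurable hX).const_mul t
  have hi2' := (hi2.comp_measurable hY).const_mul (Real.exp t - 1)
  refine (integral_sub hi1' hi2').symm.le.trans
    (integral_mono (hi1'.sub hi2') (hc.const_mul ρ) fun ω => ?_)
  exact (hM.mul_sub_mul_le hA (X ω) (Y ω) ht).trans (mul_le_mul_of_nonneg_left (hd ω) hρ)

theorem IsZCDP.comp_bound_tvDist {M : Kernel (Fin n → 𝒳) E} [IsMarkovKernel M] {ρ : ℝ}
    (hρ : 0 ≤ ρ) (hM : IsZCDP M ρ) {A : Set E} (hA : MeasurableSet A) {t : ℝ} (ht : 0 ≤ t)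
    (P P' : Measure (Fin n → 𝒳)) [IsProbabilityMeasure P] [IsProbabilityMeasure P'] :
    t * (M ∘ₘ P).real A - (Real.exp t - 1) * (M ∘ₘ P').real A
      ≤ ρ * ((n : ℝ) ^ 2 * tvDist P P') := by
  classical
  obtain ⟨π, X, Y, D, hπ, hX, hY, hD, hXY, hmX, hmY, htv⟩ := exists_maximal_coupling P P'
  refine (hM.comp_bound_of_coupling hρ hA ht hX hY hmX hmY
    (c := D.indicator fun _ => (n : ℝ) ^ 2) ((integrable_const _).indicator hD) ?_).trans ?_
  · intro ω
    by_cases hω : ω ∈ D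
    · rw [Set.indicator_of_mem hω]
      gcongr
      exact_mod_cast hammingDist_le_card_fintype.trans (by simp)
    · rw [hXY ω hω, hammingDist_self]
      simp [hω]
  · rw [integral_indicator_const _ hD, smul_eq_mul, mul_comm (π.real D)]
    gcongr

theorem IsZCDP.comp_bound_tvDist_pi {M : Kernel (Fin n → 𝒳) E} [IsMarkovKernel M] {ρ : ℝ}
    (hρ : 0 ≤ ρ) (hM : IsZCDP M ρ) {A : Set E} (hA : MeasurableSet A) {t : ℝ} (ht : 0 ≤ t)
    (p p' : Measure 𝒳) [IsProbabilityMeasure p] [IsProbabilityMeasure p'] :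
    t * (M ∘ₘ Measure.pi fun _ : Fin n => p).real A
        - (Real.exp t - 1) * (M ∘ₘ Measure.pi fun _ : Fin n => p').real A
      ≤ ρ * (n * tvDist p p' + (n : ℝ) ^ 2 * tvDist p p' ^ 2) := by
  classical
  obtain ⟨π, X, Y, D, hπ, hX, hY, hD, hXY, hmX, hmY, htv⟩ := exists_maximal_coupling p p'
  obtain ⟨hint, hle⟩ := integral_sum_indicator_sq_le (n := n) π hD
  have hmap : ∀ {Z : 𝒳 ⊕ 𝒳 × 𝒳 → 𝒳} {r : Measure 𝒳} [IsProbabilityMeasure r], Measurable Z →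
      π.map Z = r →
      (Measure.pi fun _ : Fin n => π).map (fun ω k => Z (ω k)) = Measure.pi fun _ => r := by
    intro Z r _ hZ hr
    subst hr
    exact (Measure.pi_map_pi (μ := fun _ : Fin n => π) fun _ => hZ.aemeasurable)
  refine (hM.comp_bound_of_coupling hρ hA ht (X := fun ω k => X (ω k)) (Y := fun ω k => Y (ω k))
    (by fun_prop) (by fun_prop) (hmap hX hmX) (hmap hY hmY) hint ?_).trans ?_
  · intro ω
    gcongr
    rw [hammingDist, Finset.card_filter]
    push_cast
    refine Finset.sum_le_sum fun k _ => ?_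
    by_cases hω : ω k ∈ D
    · rw [Set.indicator_of_mem hω]
      split_ifs <;> simp
    · simp [hω, hXY _ hω]
  · gcongr
    refine hle.trans ?_
    gcongr

end Privacy

end PrivateTesting

theorem mainTheorem5 {𝒳 E : Type*} [MeasurableSpace 𝒳] [MeasurableSpace E]
    (n N : ℕ) (hn : 1 ≤ n) (hN : 2 ≤ N) (ρ : ℝ) (hρ : 0 < ρ)
    (M : Kernel (Fin n → 𝒳) E) [IsMarkovKernel M] (hM : PrivateTesting.IsZCDP M ρ)
    (Ψ : E → Fin N) (hΨ : Measurable Ψ) :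
    (∀ (P : Fin N → Measure (Fin n → 𝒳)) (Q : Measure (Fin n → 𝒳)),
      (∀ i, IsProbabilityMeasure (P i)) → IsProbabilityMeasure Q → (∀ i, P i ≪ Q) →
      max
        (1 - (1 + ((1 / (N : ℝ) : ℝ) : EReal) * ∑ i : Fin N, (klDiv (P i) Q : EReal)) /
          ((Real.log N : ℝ) : EReal))
        ((1 - (1 + (n : ℝ) ^ 2 * ρ / (N : ℝ) ^ 2 *
            ∑ i : Fin N, ∑ j : Fin N,
              2 * PrivateTesting.tvDist (P i) (P j) /
                (1 + PrivateTesting.tvDist (P i) (P j))) /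
          Real.log N : ℝ) : EReal)
      ≤ ((PrivateTesting.maxTestError M P Ψ : ℝ) : EReal)) ∧
    (∀ p : Fin N → Measure 𝒳, (∀ i, IsProbabilityMeasure (p i)) →
      1 - (1 + (n : ℝ) ^ 2 * ρ / (N : ℝ) ^ 2 *
          ∑ i : Fin N, ∑ j : Fin N,
            (1 / (n : ℝ) *
                (2 * PrivateTesting.tvDist (p i) (p j) /
                  (1 + PrivateTesting.tvDist (p i) (p j))) +
              (2 * PrivateTesting.tvDist (p i) (p j) /
                (1 + PrivateTesting.tvDist (p i) (p j))) ^ 2)) /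
        Real.log N
      ≤ PrivateTesting.maxTestError M (fun i => Measure.pi (fun _ : Fin n => p i)) Ψ) := by
  have hn0 : (0 : ℝ) < n := by exact_mod_cast (by omega : 0 < n)
  have hN0 : (0 : ℝ) < N := by exact_mod_cast (by omega : 0 < N)
  have hlog : 0 ≤ Real.log N := Real.log_natCast_nonneg N
  have hA : ∀ i, MeasurableSet (Ψ ⁻¹' {i}) := fun i => hΨ (measurableSet_singleton i)
  refine ⟨fun P Q hP hQ _ =>
    max_le (PrivateTesting.fano_klDiv_le_maxTestError hN M P Q hΨ) ?_, fun p hp => ?_⟩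
  · refine EReal.coe_le_coe_iff.mpr
      (PrivateTesting.fano_le_maxTestError_of_pairwise hN M P hΨ _ fun i j => ?_)
    have := hM.comp_bound_tvDist hρ.le (hA i) hlog (P i) (P j)
    rw [Real.exp_log hN0] at this
    refine this.trans ?_
    rw [mul_comm ((n : ℝ) ^ 2) ρ, ← mul_assoc]
    gcongr
    exact PrivateTesting.tvDist_le_two_mul_div _ _
  · refine PrivateTesting.fano_le_maxTestError_of_pairwise hN M _ hΨ _ fun i j => ?_
    have := hM.comp_bound_tvDist_pi hρ.le (hA i) hlog (p i) (p j)
    rw [Real.exp_log hN0] at this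
    refine this.trans ?_
    have h0 := PrivateTesting.tvDist_nonneg (p i) (p j)
    have h1 := PrivateTesting.tvDist_le_two_mul_div (p i) (p j)
    generalize 2 * PrivateTesting.tvDist (p i) (p j) / (1 + PrivateTesting.tvDist (p i) (p j)) = b
      at h1
    calc ρ * (n * PrivateTesting.tvDist (p i) (p j)
          + (n : ℝ) ^ 2 * PrivateTesting.tvDist (p i) (p j) ^ 2)
        ≤ ρ * (n * b + (n : ℝ) ^ 2 * b ^ 2) := by gcongr
      _ = (n : ℝ) ^ 2 * ρ * (1 / n * b + b ^ 2) := by field_simp
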